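/- **Definitions.** Let $S^1=\{x\in\mathbb{C}:|x|=1\}$. For a complex Hilbert space $H$, a *normal state* on $\mathcal{B}(H)$ is a positive, unital, ultraweakly continuous linear functional $\varphi:\mathcal{B}(H)\to\mathbb{C}$. Operators $X,Y\in\mathcal{B}(H)$ are *boolean independent* with respect to $\varphi$ if $$\varphi(X^{n_1}Y^{m_1}X^{n_2}\cdots X^{n_k}Y^{m_k})=\prod_{\ell=1}^k\varphi(X^{n_\ell})\,\varphi(Y^{m_\ell})$$ for all $k\in\mathbb{N}$, $n_1,m_k\ge 0$ and $n_2,\dots,n_k,m_1,\dots,m_{k-1}\ge 1$. A probability measure $\mu$ on $S^1$ is the *distribution* of a unitary $U\in\mathcal{B}(H)$, written $\mu=\mathcal{L}_\varphi(U)$, if $\varphi(U^k)=\int_{S^1}x^k\,\mathrm{d}\mu(x)$ for all $k\in\mathbb{N}$. A *realization* of a pair $(\mu,\nu)$ of probability measures on $S^1$ consists of a complex Hilbert space $H$, a normal state $\varphi$ on $\mathcal{B}(H)$ and unitaries $U,V\in\mathcal{B}(H)$ with $\mathcal{L}_\varphi(U)=\mu$ and $\mathcal{L}_\varphi(V)=\nu$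 such that $U-1$ and $V-1$ are boolean independent with respect to $\varphi$. For a probability measure $\mu$ on $S^1$ and $|z|<1$ let $$\psi_\mu(z)=\int_{S^1}\frac{xz}{1-xz}\,\mathrm{d}\mu(x),\qquad F_\mu(z)=\frac1z\,\frac{\psi_\mu(z)}{1+\psi_\mu(z)},$$ where $F_\mu(0)$ is the value at $0$ of the continuous (equivalently, analytic) extension. **Proposition.** Let $\mu,\nu$ be probability measures on $S^1$. 1. A realization of $(\mu,\nu)$ exists. In every realization $(H,\varphi,U,V)$ of $(\mu,\nu)$ the unitary $UV$ has exactly one distribution $\mathcal{L}_\varphi(UV)$, and this probability measure depends only on $\mu$ and $\nu$, not on the realization. It is denoted by $\mu\boxtimes\nu$ and called the multiplicative boolean convolution of $\mu$ and $\nu$. 2. For all $z\in\mathbb{C}$ with $|z|<1$, $$F_{\mu\boxtimes\nu}(z)=F_\mu(z)\,F_\nu(z).$$ -/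

import Mathlib

open MeasureTheory Topology

noncomputable section

namespace BooleanConvolution

/-- The unit circle carries its Borel σ-algebra. -/
instance instMeasurableSpaceCircle : MeasurableSpace Circle := borel Circle

instance instBorelSpaceCircle : BorelSpace Circle := ⟨rfl⟩

section Operators

variable {H : Type*} [NormedAddCommGroup H] [InnerProductSpace ℂ H] [CompleteSpace H]

open scoped ComplexOrder in
/-- A normal state on `B(H)`: a positive unital linear functional which is ultraweakly
(σ-weakly) continuous, i.e. of the form `T ↦ ∑ₙ ⟨xₙ, T yₙ⟩` for two square-summable
sequences of vectors. -/
structure IsNormalState (φ : (H →L[ℂ] H) →ₗ[ℂ] ℂ) : Prop where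
  nonneg : ∀ T : H →L[ℂ] H, T.IsPositive → 0 ≤ φ T
  map_one : φ 1 = 1
  normal : ∃ x y : ℕ → H, Summable (fun n => ‖x n‖ ^ 2) ∧ Summable (fun n => ‖y n‖ ^ 2) ∧
    ∀ T : H →L[ℂ] H, HasSum (fun n => inner ℂ (x n) (T (y n))) (φ T)

/-- Boolean independence of `X` and `Y` with respect to `φ`:
`φ(X^{n₁} Y^{m₁} ⋯ X^{n_k} Y^{m_k}) = ∏ φ(X^{n_l}) φ(Y^{m_l})`, where all exponents are at
least one, except that the first exponent of `X` and the last exponent of `Y` may vanish. -/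
def BooleanIndep (φ : (H →L[ℂ] H) →ₗ[ℂ] ℂ) (X Y : H →L[ℂ] H) : Prop :=
  ∀ (k : ℕ) (n m : Fin k → ℕ),
    (∀ i : Fin k, 0 < i.val → 1 ≤ n i) →
    (∀ i : Fin k, i.val + 1 < k → 1 ≤ m i) →
    φ (List.ofFn fun i => X ^ n i * Y ^ m i).prod = ∏ i, φ (X ^ n i) * φ (Y ^ m i)

/-- The probability measure `μ` on the unit circle is the distribution of `U` in the
state `φ`. -/
def HasLaw (φ : (H →L[ℂ] H) →ₗ[ℂ] ℂ) (U : H →L[ℂ] H) (μ : ProbabilityMeasure Circle) : Prop :=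
  ∀ k : ℕ, φ (U ^ k) = ∫ x : Circle, (x : ℂ) ^ k ∂(μ : Measure Circle)

/-- `φ` is a normal state on `B(H)` and `U`, `V` are unitaries on `H` with distributions `μ`, `ν`
such that `U - 1` and `V - 1` are boolean independent. -/
structure IsRealization (φ : (H →L[ℂ] H) →ₗ[ℂ] ℂ) (U V : H →L[ℂ] H)
    (μ ν : ProbabilityMeasure Circle) : Prop where
  normalState : IsNormalState φ
  unitary_left : U ∈ unitary (H →L[ℂ] H)
  unitary_right : V ∈ unitary (H →L[ℂ] H)
  law_left : HasLaw φ U μ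
  law_right : HasLaw φ V ν
  indep : BooleanIndep φ (U - 1) (V - 1)

end Operators

/-- `ρ` is the distribution of `UV` for some realization `(U, V)` of the pair `(μ, ν)`. -/
def IsBoolConv (μ ν ρ : ProbabilityMeasure Circle) : Prop :=
  ∃ (H : Type) (_ : NormedAddCommGroup H) (_ : InnerProductSpace ℂ H) (_ : CompleteSpace H)
    (φ : (H →L[ℂ] H) →ₗ[ℂ] ℂ) (U V : H →L[ℂ] H),
    IsRealization φ U V μ ν ∧ HasLaw φ (U * V) ρ

open Classical in
/-- The multiplicative boolean convolution of two probability measures on the unit circle: a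
measure `ρ` with `IsBoolConv μ ν ρ` (with an irrelevant value if there were none). -/
def boolConv (μ ν : ProbabilityMeasure Circle) : ProbabilityMeasure Circle :=
  if h : ∃ ρ, IsBoolConv μ ν ρ then h.choose else μ

/-- `ψ_μ(z) = ∫ xz / (1 - xz) dμ(x)`. -/
def psi (μ : ProbabilityMeasure Circle) (z : ℂ) : ℂ :=
  ∫ x : Circle, ((x : ℂ) * z) / (1 - (x : ℂ) * z) ∂(μ : Measure Circle)

/-- The transform `F_μ(z) = (1/z) ψ_μ(z) / (1 + ψ_μ(z))`, extended continuously (hence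
analytically) to the origin. -/
def transformF (μ : ProbabilityMeasure Circle) : ℂ → ℂ :=
  Function.update (fun z => 1 / z * (psi μ z / (1 + psi μ z))) 0
    (Filter.limUnder (𝓝[≠] (0 : ℂ)) fun z => 1 / z * (psi μ z / (1 + psi μ z)))

/-- The limit in the definition of `transformF μ 0` exists and is the first moment of `μ`. -/
theorem tendsto_transformF (μ : ProbabilityMeasure Circle) :
    Filter.Tendsto (fun z => 1 / z * (psi μ z / (1 + psi μ z))) (𝓝[≠] (0 : ℂ))
      (𝓝 (∫ x : Circle, (x : ℂ) ∂(μ : Measure Circle))) := by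
  have hm : Measurable fun x : Circle => (x : ℂ) := Continuous.measurable (by fun_prop)
  have key : Filter.Tendsto
      (fun z : ℂ => ∫ x : Circle, (x : ℂ) / (1 - (x : ℂ) * z) ∂(μ : Measure Circle)) (𝓝 0)
      (𝓝 (∫ x : Circle, (x : ℂ) ∂(μ : Measure Circle))) := by
    apply tendsto_integral_filter_of_dominated_convergence (fun _ => (2 : ℝ))
    · refine Filter.Eventually.of_forall fun z => ?_
      exact (Measurable.div hm
        ((hm.mul_const z).const_sub 1)).aestronglyMeasurable
    · filter_upwards [Metric.ball_mem_nhds (0 : ℂ) (by norm_num : (0 : ℝ) < 1 / 2)] with z hz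
      refine Filter.Eventually.of_forall fun x => ?_
      have hz' : ‖z‖ < 1 / 2 := by simpa using hz
      have h1 : (1 / 2 : ℝ) ≤ ‖1 - (x : ℂ) * z‖ := by
        have := norm_sub_norm_le (1 : ℂ) ((x : ℂ) * z)
        rw [norm_mul, Circle.norm_coe, norm_one] at this
        linarith
      rw [norm_div, Circle.norm_coe, div_le_iff₀ (by linarith)]
      linarith
    · exact integrable_const _
    · refine Filter.Eventually.of_forall fun x => ?_
      have : ContinuousAt (fun z : ℂ => (x : ℂ) / (1 - (x : ℂ) * z)) 0 := by
        apply ContinuousAt.div <;> first | fun_prop | simp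
      simpa [ContinuousAt] using this
  have hpsi : ∀ z : ℂ, psi μ z =
      z * ∫ x : Circle, (x : ℂ) / (1 - (x : ℂ) * z) ∂(μ : Measure Circle) := by
    intro z
    rw [psi, ← integral_const_mul]
    congr 1
    ext x
    ring
  have hpsi0 : Filter.Tendsto (fun z => 1 + psi μ z) (𝓝 (0 : ℂ)) (𝓝 1) := by
    have h := (tendsto_const_nhds (x := (1 : ℂ)) (f := 𝓝 (0 : ℂ))).add
      ((Filter.tendsto_id (x := 𝓝 (0 : ℂ))).mul key)
    simp only [id, zero_mul, add_zero] at h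
    exact h.congr fun z => by rw [hpsi z]
  have hq := (key.div hpsi0 one_ne_zero).mono_left (nhdsWithin_le_nhds (s := {0}ᶜ))
  rw [div_one] at hq
  refine hq.congr' ?_
  filter_upwards [self_mem_nhdsWithin] with z hz
  have hz' : z ≠ 0 := hz
  simp only [Pi.div_apply]
  rw [← mul_div_assoc]
  congr 1
  rw [hpsi z, ← mul_assoc, one_div, inv_mul_cancel₀ hz', one_mul]

theorem transformF_zero (μ : ProbabilityMeasure Circle) :
    transformF μ 0 = ∫ x : Circle, (x : ℂ) ∂(μ : Measure Circle) := by
  simpa [transformF] using (tendsto_transformF μ).limUnder_eq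

end BooleanConvolution

end

/-! Uniqueness is combinatorial. Every word in `U - 1` and `V - 1` alternates, so boolean
independence expresses its expectation through the moments of `μ` and `ν`. Expanding `(UV)^k = ((1 +
(U-1))(1 + (V-1)))^k` shows that the moments of `UV` are the same in all realizations
(`IsRealization.map_mul_pow`). Nonnegative moments determine a measure on the circle
(`ext_of_moments`), and continuous functional calculus with Riesz–Markov produces one
(`exists_hasLaw`).

It therefore suffices to find one convenient realization. Represent each measure by a unitary with a
cyclic vector and glue the two spaces along these vectors. In the result, `V - 1` annihilates the
part of `U^n Ω` orthogonal to `Ω`, and vice versa (`Decoupled`). This gives boolean independence.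

The product formula is computed in this model. Since `zF = 1 - 1/(1+ψ)` and `1 + ψ` is the vacuum
expectation of the resolvent `(1 - zU)⁻¹`, it is enough to solve `(1 - zUV) f = (1 - z F_μ F_ν) Ω`
with `⟨Ω, f⟩ = 1`. The solution `f` is explicit in the resolvent vectors of `U` and `V`
(`Decoupled.transformF_mul`). -/

noncomputable section

namespace BooleanConvolution

/-! ### Words in `U - 1` and `V - 1`, and the moments of `UV`. -/

/-- Every word in two letters is an alternating product of powers in which only the first and the
last exponent may vanish. -/
theorem FreeMonoid.exists_alternating (w : FreeMonoid Bool) :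
    ∃ (k : ℕ) (n m : Fin (k + 1) → ℕ),
      (∀ i : Fin (k + 1), 0 < i.val → 1 ≤ n i) ∧
      (∀ i : Fin (k + 1), i.val + 1 < k + 1 → 1 ≤ m i) ∧
      w = (List.ofFn fun i => FreeMonoid.of true ^ n i * FreeMonoid.of false ^ m i).prod := by
  induction w using FreeMonoid.inductionOn' with
  | one => exact ⟨0, fun _ => 0, fun _ => 0, by simp, by simp, by simp⟩
  | of_mul b w ih =>
    obtain ⟨k, n, m, hn, hm, rfl⟩ := ih
    cases b with
    | true =>
      refine ⟨k, Fin.cons (n 0 + 1) (fun i => n i.succ), m, ?_, hm, ?_⟩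
      · intro i hi
        induction i using Fin.cases with
        | zero => simp
        | succ i => simpa using hn i.succ (by simp)
      · simp [List.ofFn_succ, pow_succ', mul_assoc]
    | false =>
      -- A prepended second letter joins the leading block if that block has no first letter.
      -- Otherwise it opens a new block with exponents `0` and `1`.
      by_cases h0 : n 0 = 0
      · refine ⟨k, n, Fin.cons (m 0 + 1) (fun i => m i.succ), hn, ?_, ?_⟩
        · intro i hi
          induction i using Fin.cases with
          | zero => simp
          | succ i => simpa using hm i.succ hi
        · simp [List.ofFn_succ, h0, pow_succ', mul_assoc]
      · refine ⟨k + 1, Fin.cons 0 n, Fin.cons 1 m, ?_, ?_, ?_⟩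
        · intro i hi
          induction i using Fin.cases with
          | zero => simp at hi
          | succ i =>
            simp only [Fin.cons_succ]
            by_cases hi0 : i = 0
            · subst hi0; omega
            · exact hn i (Nat.pos_of_ne_zero fun h => hi0 (Fin.ext h))
        · intro i hi
          induction i using Fin.cases with
          | zero => simp
          | succ i =>
            simp only [Fin.cons_succ]
            exact hm i (by simpa using hi)
        · rw [List.ofFn_succ (n := k + 1)]
          simp

section
variable {H : Type*} [NormedAddCommGroup H] [InnerProductSpace ℂ H]
  {H' : Type*} [NormedAddCommGroup H'] [InnerProductSpace ℂ H']

theorem HasLaw.map_aeval {φ : (H →L[ℂ] H) →ₗ[ℂ] ℂ} {φ' : (H' →L[ℂ] H') →ₗ[ℂ] ℂ}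
    {U : H →L[ℂ] H} {U' : H' →L[ℂ] H'} {μ : ProbabilityMeasure Circle}
    (h : HasLaw φ U μ) (h' : HasLaw φ' U' μ) (p : Polynomial ℂ) :
    φ (Polynomial.aeval U p) = φ' (Polynomial.aeval U' p) := by
  simp only [Polynomial.aeval_eq_sum_range, map_sum, map_smul, h _, h' _]

theorem HasLaw.sub_one_pow {φ : (H →L[ℂ] H) →ₗ[ℂ] ℂ} {φ' : (H' →L[ℂ] H') →ₗ[ℂ] ℂ}
    {U : H →L[ℂ] H} {U' : H' →L[ℂ] H'} {μ : ProbabilityMeasure Circle}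
    (h : HasLaw φ U μ) (h' : HasLaw φ' U' μ) (n : ℕ) :
    φ ((U - 1) ^ n) = φ' ((U' - 1) ^ n) := by
  have := h.map_aeval h' ((Polynomial.X - 1) ^ n)
  simp only [Polynomial.aeval_X, map_pow (Polynomial.aeval _), map_sub (Polynomial.aeval _),
    map_one (Polynomial.aeval _)] at this
  exact this

variable [CompleteSpace H] [CompleteSpace H']

theorem IsRealization.map_word {φ : (H →L[ℂ] H) →ₗ[ℂ] ℂ} {φ' : (H' →L[ℂ] H') →ₗ[ℂ] ℂ}
    {U V : H →L[ℂ] H} {U' V' : H' →L[ℂ] H'} {μ ν : ProbabilityMeasure Circle}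
    (h : IsRealization φ U V μ ν) (h' : IsRealization φ' U' V' μ ν) (w : FreeMonoid Bool) :
    φ (FreeMonoid.lift (fun b => bif b then U - 1 else V - 1) w) =
      φ' (FreeMonoid.lift (fun b => bif b then U' - 1 else V' - 1) w) := by
  obtain ⟨k, n, m, hn, hm, rfl⟩ := FreeMonoid.exists_alternating w
  simp only [map_list_prod, List.map_ofFn, Function.comp_def, map_mul, map_pow,
    FreeMonoid.lift_eval_of, cond_true, cond_false]
  rw [h.indep _ n m hn hm, h'.indep _ n m hn hm]
  simp only [h.law_left.sub_one_pow h'.law_left, h.law_right.sub_one_pow h'.law_right]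

/-- By linearity agreement on words suffices. The extension is needed because `UV` is a polynomial
in the shifted unitaries, not a word in them. -/
theorem IsRealization.map_freeAlgebra
    {φ : (H →L[ℂ] H) →ₗ[ℂ] ℂ} {φ' : (H' →L[ℂ] H') →ₗ[ℂ] ℂ}
    {U V : H →L[ℂ] H} {U' V' : H' →L[ℂ] H'} {μ ν : ProbabilityMeasure Circle}
    (h : IsRealization φ U V μ ν) (h' : IsRealization φ' U' V' μ ν)
    (p : MonoidAlgebra ℂ (FreeMonoid Bool)) :
    φ (MonoidAlgebra.lift ℂ _ _ (FreeMonoid.lift fun b => bif b then U - 1 else V - 1) p) =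
      φ' (MonoidAlgebra.lift ℂ _ _
        (FreeMonoid.lift fun b => bif b then U' - 1 else V' - 1) p) := by
  induction p using MonoidAlgebra.induction_linear with
  | zero => simp
  | add p q hp hq => simp only [map_add, hp, hq]
  | single w c =>
    simp only [MonoidAlgebra.lift_single, map_smul, h.map_word h' w]

/-- The moments of `UV` are the same in all realizations of a pair of measures. -/
theorem IsRealization.map_mul_pow
    {φ : (H →L[ℂ] H) →ₗ[ℂ] ℂ} {φ' : (H' →L[ℂ] H') →ₗ[ℂ] ℂ}
    {U V : H →L[ℂ] H} {U' V' : H' →L[ℂ] H'} {μ ν : ProbabilityMeasure Circle}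
    (h : IsRealization φ U V μ ν) (h' : IsRealization φ' U' V' μ ν) (k : ℕ) :
    φ ((U * V) ^ k) = φ' ((U' * V') ^ k) := by
  let x : Bool → MonoidAlgebra ℂ (FreeMonoid Bool) := fun b =>
    1 + MonoidAlgebra.of ℂ _ (FreeMonoid.of b)
  have := h.map_freeAlgebra h' ((x true * x false) ^ k)
  simpa [x] using this

end

/-! ### Measures on the circle and their moments. -/

theorem integrable_continuousMap_circle (μ : Measure Circle) [IsFiniteMeasure μ] (f : C(Circle, ℂ)) :
    Integrable f μ :=
  Continuous.integrable_of_hasCompactSupport f.continuous (HasCompactSupport.of_compactSpace _)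

/-- On the circle `x⁻¹` is the conjugate of `x`, so negative moments are conjugates of positive
ones. -/
theorem integral_circle_zpow_eq {μ ν : ProbabilityMeasure Circle}
    (h : ∀ k : ℕ, ∫ x : Circle, (x : ℂ) ^ k ∂(μ : Measure Circle) =
      ∫ x : Circle, (x : ℂ) ^ k ∂(ν : Measure Circle)) (k : ℤ) :
    ∫ x : Circle, ((x ^ k : Circle) : ℂ) ∂(μ : Measure Circle) =
      ∫ x : Circle, ((x ^ k : Circle) : ℂ) ∂(ν : Measure Circle) := by
  obtain ⟨n, rfl | rfl⟩ := k.eq_nat_or_neg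
  · simpa using h n
  · have h1 : ∀ x : Circle, ((x ^ (-(n : ℤ)) : Circle) : ℂ) =
        (starRingEnd ℂ) ((x : ℂ) ^ n) := fun x => by
      rw [zpow_neg, Circle.coe_inv_eq_conj, zpow_natCast, Circle.coe_pow]
    simp only [h1, integral_conj, h n]

open BoundedContinuousFunction in
/-- A probability measure on the circle is determined by its moments of nonnegative order. -/
theorem ext_of_moments {μ ν : ProbabilityMeasure Circle}
    (h : ∀ k : ℕ, ∫ x : Circle, (x : ℂ) ^ k ∂(μ : Measure Circle) =
      ∫ x : Circle, (x : ℂ) ^ k ∂(ν : Measure Circle)) : μ = ν := by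
  let χ : Circle →ᵇ ℂ := mkOfCompact ⟨fun x => (x : ℂ), by fun_prop⟩
  let A : StarSubalgebra ℂ (Circle →ᵇ ℂ) := StarAlgebra.adjoin ℂ {χ}
  -- The star algebra generated by the coordinate consists of Laurent polynomials. It separates
  -- points, so equality of integrals on it is enough.
  have hmem : ∀ g ∈ A, g ∈ Submodule.span ℂ
      {g : Circle →ᵇ ℂ | ∃ k : ℤ, ∀ x : Circle, g x = ((x ^ k : Circle) : ℂ)} := by
    intro g hg
    have hg' : g ∈ Algebra.adjoin ℂ ({χ} ∪ star {χ} : Set (Circle →ᵇ ℂ)) := hg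
    rw [← Subalgebra.mem_toSubmodule, Algebra.adjoin_eq_span] at hg'
    refine Submodule.span_mono (fun f hf => ?_) hg'
    induction hf using Submonoid.closure_induction with
    | mem f hf =>
      rcases hf with rfl | hf
      · exact ⟨1, fun x => by rw [zpow_one]; rfl⟩
      · refine ⟨-1, fun x => ?_⟩
        have : f = star χ := by
          rw [← hf, star_star]
        rw [this, zpow_neg_one, Circle.coe_inv_eq_conj]
        rfl
    | one => exact ⟨0, fun x => by simp⟩
    | mul f g _ _ hf hg =>
      obtain ⟨k, hk⟩ := hf
      obtain ⟨l, hl⟩ := hg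
      exact ⟨k + l, fun x => by rw [mul_apply, hk, hl, zpow_add, Circle.coe_mul]⟩
  apply Subtype.ext
  have : IsFiniteMeasure (μ : Measure Circle) := inferInstance
  have : IsFiniteMeasure (ν : Measure Circle) := inferInstance
  refine ext_of_forall_mem_subalgebra_integral_eq_of_polish (𝕜 := ℂ) (A := A)
    (P := (μ : Measure Circle)) (P' := (ν : Measure Circle)) ?_ fun g hg => ?_
  · intro x y hxy
    refine ⟨_, ⟨_, ⟨χ, StarAlgebra.subset_adjoin ℂ _ rfl, rfl⟩, rfl⟩, ?_⟩
    exact fun he => hxy (Circle.ext he)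
  · replace hg := hmem g hg
    induction hg using Submodule.span_induction with
    | mem f hf =>
      obtain ⟨k, hk⟩ := hf
      simpa only [hk] using integral_circle_zpow_eq h k
    | zero => simp
    | add f g _ _ hf hg =>
      simp only [BoundedContinuousFunction.add_apply]
      rw [integral_add (f.integrable _) (g.integrable _),
        integral_add (f.integrable _) (g.integrable _), hf, hg]
    | smul c f _ hf =>
      simp only [BoundedContinuousFunction.smul_apply]
      rw [integral_smul, integral_smul, hf]

/-! ### Existence of the distribution of a unitary. -/

section
variable {H : Type*} [NormedAddCommGroup H] [InnerProductSpace ℂ H] [CompleteSpace H]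

/-- The functional calculus of a unitary for continuous functions on the circle. -/
theorem exists_circle_functionalCalculus {W : H →L[ℂ] H} (hW : W ∈ unitary (H →L[ℂ] H)) :
    ∃ π : C(Circle, ℂ) →⋆ₐ[ℂ] (H →L[ℂ] H), π ⟨fun x => (x : ℂ), by fun_prop⟩ = W := by
  have hn : IsStarNormal W := (unitary_iff_isStarNormal_and_spectrum_subset_unitary.mp hW).1
  have hs : ∀ x ∈ spectrum ℂ W, x ∈ Submonoid.unitSphere ℂ := fun x hx => by
    have := spectrum.subset_circle_of_unitary hW hx
    exact this
  let ι : C(spectrum ℂ W, Circle) :=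
    ⟨fun x => ⟨x.1, hs x.1 x.2⟩, by
      refine Continuous.subtype_mk ?_ _
      fun_prop⟩
  refine ⟨(cfcHom hn).comp (ContinuousMap.compStarAlgHom' ℂ ℂ ι), ?_⟩
  exact cfcHom_id hn

open scoped ComplexOrder CompactlySupported in
/-- A positive unital functional on `B(H)` gives every unitary a distribution. -/
theorem exists_hasLaw {φ : (H →L[ℂ] H) →ₗ[ℂ] ℂ}
    (hpos : ∀ T : H →L[ℂ] H, T.IsPositive → 0 ≤ φ T) (hone : φ 1 = 1)
    {W : H →L[ℂ] H} (hW : W ∈ unitary (H →L[ℂ] H)) :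
    ∃ ρ : ProbabilityMeasure Circle, HasLaw φ W ρ := by
  obtain ⟨π, hπ⟩ := exists_circle_functionalCalculus hW
  let c : C(Circle, ℝ) →ₗ[ℝ] C(Circle, ℂ) :=
    { toFun := fun f => ⟨fun x => (f x : ℂ), by fun_prop⟩
      map_add' := fun f g => by ext; simp
      map_smul' := fun r f => by ext; simp }
  have hc : ∀ f : C(Circle, ℝ), 0 ≤ f → 0 ≤ φ (π (c f)) := fun f hf => by
    have h1 : c f = star (c ⟨fun x => √(f x), by fun_prop⟩) * c ⟨fun x => √(f x), by fun_prop⟩ := by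
      ext x
      simp only [c, LinearMap.coe_mk, AddHom.coe_mk, ContinuousMap.coe_mk, ContinuousMap.mul_apply,
        ContinuousMap.star_apply, RCLike.star_def, Complex.conj_ofReal]
      rw [← Complex.ofReal_mul]
      exact congrArg _ (Real.mul_self_sqrt (hf x)).symm
    rw [h1, map_mul, map_star]
    exact hpos _ (ContinuousLinearMap.nonneg_iff_isPositive _ |>.mp (star_mul_self_nonneg _))
  -- Positivity makes the functional real on real functions, through positive and negative parts.
  -- Hence the real-valued functional fed to Riesz–Markov loses nothing.
  have hre : ∀ f : C(Circle, ℝ), φ (π (c f)) = ((φ (π (c f))).re : ℂ) := fun f => by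
    have h1 : f = f ⊔ 0 - (-f) ⊔ 0 := by
      ext x
      simp [max_zero_sub_max_neg_zero_eq_self]
    have h2 := (Complex.nonneg_iff.mp (hc (f ⊔ 0) le_sup_right)).2
    have h3 := (Complex.nonneg_iff.mp (hc ((-f) ⊔ 0) le_sup_right)).2
    apply Complex.ext
    · simp
    · rw [h1]
      simp [← h2, ← h3]
  let Λ₀ : C_c(Circle, ℝ) →ₗ[ℝ] ℝ :=
    { toFun := fun f => (φ (π (c f.toContinuousMap))).re
      map_add' := fun f g => by
        have : (f + g).toContinuousMap = f.toContinuousMap + g.toContinuousMap := rfl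
        simp [this]
      map_smul' := fun r f => by
        have : c (r • f).toContinuousMap = (r : ℂ) • c f.toContinuousMap := by
          ext x; simp [c]
        simp only [this, map_smul, smul_eq_mul, Complex.re_ofReal_mul, RingHom.id_apply] }
  let Λ : C_c(Circle, ℝ) →ₚ[ℝ] ℝ := PositiveLinearMap.mk₀ Λ₀ fun f hf =>
    (Complex.nonneg_iff.mp (hc f.toContinuousMap hf)).1
  let ρ := RealRMK.rieszMeasure Λ
  have hρ : ∀ f : C(Circle, ℝ), ∫ x, f x ∂ρ = (φ (π (c f))).re := fun f =>
    RealRMK.integral_rieszMeasure Λ (CompactlySupportedContinuousMap.continuousMapEquiv f)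
  have hprob : IsProbabilityMeasure ρ := by
    have h1 := hρ 1
    have h2 : c 1 = 1 := by ext; simp [c]
    rw [h2, map_one, hone] at h1
    simp only [ContinuousMap.one_apply, integral_const, smul_eq_mul, mul_one, Complex.one_re] at h1
    refine ⟨?_⟩
    rw [Measure.real] at h1
    exact (ENNReal.toReal_eq_one_iff _).mp h1
  refine ⟨⟨ρ, hprob⟩, fun k => ?_⟩
  let p : C(Circle, ℂ) := ⟨fun x => (x : ℂ) ^ k, by fun_prop⟩
  have hp : π p = W ^ k := by
    rw [← hπ, ← map_pow]
    rfl
  let a : C(Circle, ℝ) := ⟨fun x => ((x : ℂ) ^ k).re, by fun_prop⟩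
  let b : C(Circle, ℝ) := ⟨fun x => ((x : ℂ) ^ k).im, by fun_prop⟩
  have hab : p = c a + Complex.I • c b := by
    ext x
    simp only [p, c, a, b, LinearMap.coe_mk, AddHom.coe_mk, ContinuousMap.coe_mk,
      ContinuousMap.add_apply, ContinuousMap.smul_apply, smul_eq_mul]
    rw [mul_comm, Complex.re_add_im]
  have hI : Integrable (fun x : Circle => (x : ℂ) ^ k) ρ := integrable_continuousMap_circle ρ p
  have hint : ∫ x : Circle, (x : ℂ) ^ k ∂ρ = φ (W ^ k) := by
    rw [← integral_re_add_im hI, ← hp, hab, map_add, map_add, map_smul, map_smul, hre a, hre b,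
      ← hρ a, ← hρ b, smul_eq_mul, mul_comm Complex.I]
    rfl
  exact hint.symm

end

/-! ### Vector states and decoupled pairs. -/

section
variable {H : Type*} [NormedAddCommGroup H] [InnerProductSpace ℂ H]

/-- The functional `T ↦ ⟨Ω, T Ω⟩`. -/
def vectorState (Ω : H) : (H →L[ℂ] H) →ₗ[ℂ] ℂ where
  toFun T := inner ℂ Ω (T Ω)
  map_add' S T := by simp
  map_smul' c T := by simp

theorem vectorState_apply (Ω : H) (T : H →L[ℂ] H) : vectorState Ω T = inner ℂ Ω (T Ω) := rfl

theorem inner_self_of_norm_one {Ω : H} (hΩ : ‖Ω‖ = 1) : inner ℂ Ω Ω = (1 : ℂ) := by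
  rw [inner_self_eq_norm_sq_to_K, hΩ]; simp

theorem isNormalState_vectorState [CompleteSpace H] {Ω : H} (hΩ : ‖Ω‖ = 1) : IsNormalState (vectorState Ω) where
  nonneg T hT := hT.inner_nonneg_right Ω
  map_one := inner_self_of_norm_one hΩ
  normal := by
    refine ⟨Pi.single 0 Ω, Pi.single 0 Ω, ?_, ?_, fun T => ?_⟩
    · refine summable_of_ne_finset_zero (s := {0}) fun n hn => ?_
      simp [Finset.mem_singleton.not.mp hn]
    · refine summable_of_ne_finset_zero (s := {0}) fun n hn => ?_
      simp [Finset.mem_singleton.not.mp hn]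
    · have := hasSum_single (f := fun n => inner ℂ ((Pi.single 0 Ω : ℕ → H) n)
        (T ((Pi.single 0 Ω : ℕ → H) n))) 0 (fun n hn => by simp [hn])
      simpa [vectorState_apply] using this

/-- The cyclic space of `U` generated by `Ω` splits off `Ω` from a part on which `V` is trivial. -/
def Decoupled (Ω : H) (U V : H →L[ℂ] H) : Prop :=
  ∀ n : ℕ, (V - 1) ((U ^ n) Ω) = vectorState Ω (U ^ n) • (V - 1) Ω

theorem Decoupled.aeval {Ω : H} {U V : H →L[ℂ] H} (h : Decoupled Ω U V) (p : Polynomial ℂ) :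
    (V - 1) (Polynomial.aeval U p Ω) = vectorState Ω (Polynomial.aeval U p) • (V - 1) Ω := by
  induction p using Polynomial.induction_on' with
  | add p q hp hq => simp only [map_add, add_apply, hp, hq, add_smul]
  | monomial n a =>
    rw [Polynomial.aeval_monomial, ← Algebra.smul_def, map_smul, smul_apply,
      map_smul, h n, smul_assoc]

theorem Decoupled.pow_apply {Ω : H} {U V : H →L[ℂ] H} (h : Decoupled Ω U V) (n : ℕ) {m : ℕ}
    (hm : 1 ≤ m) :
    ((V - 1) ^ m) (((U - 1) ^ n) Ω) = vectorState Ω ((U - 1) ^ n) • ((V - 1) ^ m) Ω := by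
  obtain ⟨m, rfl⟩ := Nat.exists_eq_add_of_le' hm
  have := h.aeval ((Polynomial.X - 1) ^ n)
  simp only [map_pow, map_sub, Polynomial.aeval_X, map_one] at this
  rw [pow_succ, mul_apply_eq_comp, this, map_smul, mul_apply_eq_comp]

/-- Blocks are evaluated from the right: each inner power, applied to `Ω`, acts as its expectation
times `Ω` under the next power to its left. The leftmost block stays, since its first exponent may
vanish. -/
theorem Decoupled.alternating_apply {Ω : H} {U V : H →L[ℂ] H} (hUV : Decoupled Ω U V)
    (hVU : Decoupled Ω V U) (k : ℕ) (n m : Fin (k + 1) → ℕ)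
    (hn : ∀ i : Fin (k + 1), 0 < i.val → 1 ≤ n i)
    (hm : ∀ i : Fin (k + 1), i.val + 1 < k + 1 → 1 ≤ m i) :
    (List.ofFn fun i => (U - 1) ^ n i * (V - 1) ^ m i).prod Ω =
      (∏ i : Fin k, vectorState Ω ((U - 1) ^ n i.succ) * vectorState Ω ((V - 1) ^ m i.succ)) •
        ((U - 1) ^ n 0) (((V - 1) ^ m 0) Ω) := by
  induction k with
  | zero => simp
  | succ k ih =>
    rw [List.ofFn_succ, List.prod_cons, mul_apply_eq_comp,
      ih (fun i => n i.succ) (fun i => m i.succ) (fun i _ => hn _ (by simp))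
        (fun i hi => hm _ (by simpa using hi)),
      hVU.pow_apply _ (hn _ (by simp)), mul_apply_eq_comp, map_smul, map_smul,
      map_smul, hUV.pow_apply _ (hm _ (by simp)), map_smul, map_smul, smul_smul, smul_smul,
      Fin.prod_univ_succ (n := k)]
    congr 1
    ring

theorem Decoupled.booleanIndep {Ω : H} {U V : H →L[ℂ] H} (hΩ : ‖Ω‖ = 1)
    (hUV : Decoupled Ω U V) (hVU : Decoupled Ω V U) :
    BooleanIndep (vectorState Ω) (U - 1) (V - 1) := by
  intro k n m hn hm
  cases k with
  | zero => simpa [vectorState_apply] using inner_self_of_norm_one hΩ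
  | succ k =>
    rw [vectorState_apply, hUV.alternating_apply hVU k n m hn hm, inner_smul_right,
      Fin.prod_univ_succ, mul_comm]
    congr 1
    rcases Nat.eq_zero_or_pos (n 0) with h0 | h0
    · simp [h0, vectorState_apply, hΩ]
    · rw [hVU.pow_apply _ h0, inner_smul_right, mul_comm]
      rfl

/-! ### Moment generating functions and resolvents. -/

theorem one_sub_circle_mul_ne_zero {z : ℂ} (hz : ‖z‖ < 1) (x : Circle) :
    1 - (x : ℂ) * z ≠ 0 := fun h => by
  have h1 : ‖(x : ℂ) * z‖ < 1 := by rwa [norm_mul, Circle.norm_coe, one_mul]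
  rw [← sub_eq_zero.mp h] at h1
  simp at h1

theorem integrable_psi (μ : ProbabilityMeasure Circle) {z : ℂ} (hz : ‖z‖ < 1) :
    Integrable (fun x : Circle => (x : ℂ) * z / (1 - (x : ℂ) * z)) (μ : Measure Circle) :=
  Continuous.integrable_of_hasCompactSupport
    (Continuous.div (by fun_prop) (by fun_prop) (one_sub_circle_mul_ne_zero hz))
    (HasCompactSupport.of_compactSpace _)

/-- The real part plus `1/2` equals `(1 - |w|²) / (2|1 - w|²)`. Integrated, this keeps `1 + ψ` away
from zero. -/
theorem neg_half_le_re_div_one_sub {w : ℂ} (hw : ‖w‖ < 1) : -(1 / 2) ≤ (w / (1 - w)).re := by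
  have hne : 1 - w ≠ 0 := fun h => by
    rw [← sub_eq_zero.mp h] at hw
    simp at hw
  have hpos : 0 < Complex.normSq (1 - w) := Complex.normSq_pos.mpr hne
  have h1 : Complex.normSq w < 1 := by
    rw [Complex.normSq_eq_norm_sq]
    nlinarith [norm_nonneg w]
  rw [Complex.div_re, ← add_div, le_div_iff₀ hpos]
  simp only [Complex.normSq_apply, Complex.sub_re, Complex.one_re, Complex.sub_im,
    Complex.one_im] at h1 ⊢
  nlinarith

theorem one_add_psi_ne_zero (μ : ProbabilityMeasure Circle) {z : ℂ} (hz : ‖z‖ < 1) :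
    1 + psi μ z ≠ 0 := by
  have h1 : (psi μ z).re =
      ∫ x : Circle, ((x : ℂ) * z / (1 - (x : ℂ) * z)).re ∂(μ : Measure Circle) :=
    (Complex.reCLM.integral_comp_comm (integrable_psi μ hz)).symm
  have h2 : ∫ _ : Circle, (-(1 / 2) : ℝ) ∂(μ : Measure Circle) ≤ (psi μ z).re := by
    rw [h1]
    refine integral_mono (integrable_const _) (integrable_psi μ hz).re fun x => ?_
    exact neg_half_le_re_div_one_sub (by rwa [norm_mul, Circle.norm_coe, one_mul])
  rw [integral_const, probReal_univ, one_smul] at h2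
  intro h
  have := congrArg Complex.re h
  simp only [Complex.add_re, Complex.one_re, Complex.zero_re] at this
  linarith

/-- The transform `1 + ψ_μ` is the generating function of the moments of `μ`. -/
theorem hasSum_moments (μ : ProbabilityMeasure Circle) {z : ℂ} (hz : ‖z‖ < 1) :
    HasSum (fun n : ℕ => z ^ n * ∫ x : Circle, (x : ℂ) ^ n ∂(μ : Measure Circle))
      (1 + psi μ z) := by
  have hint : ∀ n : ℕ, Integrable (fun x : Circle => ((x : ℂ) * z) ^ n) (μ : Measure Circle) :=
    fun n => (Continuous.integrable_of_hasCompactSupport (by fun_prop)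
      (HasCompactSupport.of_compactSpace _))
  have hlt : ∀ x : Circle, ‖(x : ℂ) * z‖ < 1 := fun x => by
    rwa [norm_mul, Circle.norm_coe, one_mul]
  have hne := one_sub_circle_mul_ne_zero hz
  have key := hasSum_integral_of_summable_integral_norm hint (by
    simpa [Circle.norm_coe] using summable_geometric_of_lt_one (norm_nonneg z) hz)
  have hI : Integrable (fun x : Circle => (x : ℂ) * z / (1 - (x : ℂ) * z)) (μ : Measure Circle) :=
    integrable_psi μ hz
  have h1 : 1 + psi μ z = ∫ x : Circle, ∑' n : ℕ, ((x : ℂ) * z) ^ n ∂(μ : Measure Circle) := by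
    have h2 : (1 : ℂ) = ∫ x : Circle, (1 : ℂ) ∂(μ : Measure Circle) := by simp
    rw [h2, psi, ← integral_add (integrable_const _) hI]
    refine integral_congr_ae (Filter.Eventually.of_forall fun x => ?_)
    have := hne x
    simp only [tsum_geometric_of_norm_lt_one (hlt x)]
    field_simp
    ring
  rw [h1]
  refine key.congr_fun fun n => ?_
  rw [← integral_const_mul]
  simp only [mul_pow, mul_comm]

variable [CompleteSpace H]

theorem norm_smul_unitary_lt_one {U : H →L[ℂ] H} (hU : U ∈ unitary (H →L[ℂ] H)) {z : ℂ}
    (hz : ‖z‖ < 1) : ‖z • U‖ < 1 := by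
  refine (norm_smul_le z U).trans_lt ?_
  have : ‖U‖ ≤ 1 := by
    rcases subsingleton_or_nontrivial (H →L[ℂ] H) with _ | _
    · rw [Subsingleton.elim U 0, norm_zero]
      exact zero_le_one
    · exact (CStarRing.norm_of_mem_unitary hU).le
  nlinarith [norm_nonneg z, norm_nonneg U]

theorem hasSum_resolvent_apply {U : H →L[ℂ] H} (hU : U ∈ unitary (H →L[ℂ] H)) {z : ℂ}
    (hz : ‖z‖ < 1) (Ω : H) :
    HasSum (fun n : ℕ => z ^ n • (U ^ n) Ω) ((∑' n : ℕ, (z • U) ^ n) Ω) := by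
  have h := (summable_geometric_of_norm_lt_one (norm_smul_unitary_lt_one hU hz)).hasSum
  have := h.mapL (ContinuousLinearMap.apply ℂ H Ω)
  simpa [smul_pow] using this

theorem HasLaw.inner_resolvent {Ω : H} {U : H →L[ℂ] H} {μ : ProbabilityMeasure Circle}
    (hU : U ∈ unitary (H →L[ℂ] H)) (h : HasLaw (vectorState Ω) U μ) {z : ℂ} (hz : ‖z‖ < 1) :
    inner ℂ Ω ((∑' n : ℕ, (z • U) ^ n) Ω) = 1 + psi μ z := by
  have h1 := (hasSum_resolvent_apply hU hz Ω).mapL (innerSL ℂ Ω)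
  refine h1.unique ?_
  refine (hasSum_moments μ hz).congr_fun fun n => ?_
  simp only [map_smul, innerSL_apply_apply, smul_eq_mul, ← h n]
  rfl

/-- Apply decoupling to each term of the Neumann series; the coefficients sum to the moment
generating function. -/
theorem Decoupled.resolvent {Ω : H} {U V : H →L[ℂ] H} {μ : ProbabilityMeasure Circle}
    (hd : Decoupled Ω U V)
    (hU : U ∈ unitary (H →L[ℂ] H)) (h : HasLaw (vectorState Ω) U μ) {z : ℂ} (hz : ‖z‖ < 1) :
    (V - 1) ((∑' n : ℕ, (z • U) ^ n) Ω) = (1 + psi μ z) • (V - 1) Ω := by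
  have h1 := (hasSum_resolvent_apply hU hz Ω).mapL (V - 1)
  refine h1.unique ?_
  refine ((hasSum_moments μ hz).smul_const ((V - 1) Ω)).congr_fun fun n => ?_
  rw [map_smul, hd n, h n, smul_smul]

theorem smul_apply_resolvent {U : H →L[ℂ] H} (hU : U ∈ unitary (H →L[ℂ] H)) {z : ℂ}
    (hz : ‖z‖ < 1) (Ω : H) :
    z • U ((∑' n : ℕ, (z • U) ^ n) Ω) = (∑' n : ℕ, (z • U) ^ n) Ω - Ω := by
  have := congrArg (fun T : H →L[ℂ] H => T Ω)
    (mul_neg_geom_series (z • U) (norm_smul_unitary_lt_one hU hz))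
  simp only [mul_apply_eq_comp, sub_apply,
    one_apply_eq_self, smul_apply] at this
  rw [eq_sub_iff_add_eq, ← eq_sub_iff_add_eq', this]

theorem resolvent_apply_sub {U : H →L[ℂ] H} (hU : U ∈ unitary (H →L[ℂ] H)) {z : ℂ}
    (hz : ‖z‖ < 1) (f : H) :
    (∑' n : ℕ, (z • U) ^ n) (f - z • U f) = f :=
  congrArg (fun T : H →L[ℂ] H => T f)
    (geom_series_mul_neg (z • U) (norm_smul_unitary_lt_one hU hz))

theorem transformF_of_ne_zero (μ : ProbabilityMeasure Circle) {z : ℂ} (hz : ‖z‖ < 1)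
    (h0 : z ≠ 0) : z * transformF μ z = 1 - (1 + psi μ z)⁻¹ := by
  have := one_add_psi_ne_zero μ hz
  rw [transformF, Function.update_of_ne h0]
  field_simp
  ring

/-- In a decoupled pair, the transform of the distribution of the product is the product of the
transforms. -/
theorem Decoupled.transformF_mul {Ω : H} {U V : H →L[ℂ] H} {μ ν ρ : ProbabilityMeasure Circle}
    (hΩ : ‖Ω‖ = 1) (hUV : Decoupled Ω U V) (hVU : Decoupled Ω V U)
    (hU : U ∈ unitary (H →L[ℂ] H)) (hV : V ∈ unitary (H →L[ℂ] H))
    (hμ : HasLaw (vectorState Ω) U μ) (hν : HasLaw (vectorState Ω) V ν)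
    (hρ : HasLaw (vectorState Ω) (U * V) ρ) {z : ℂ} (hz : ‖z‖ < 1) :
    transformF ρ z = transformF μ z * transformF ν z := by
  -- At the origin the claim is multiplicativity of first moments, which is decoupling for the first
  -- power paired with `Ω`.
  rcases eq_or_ne z 0 with rfl | h0
  · have h1 := hVU 1
    have hμ1 := hμ 1
    have hν1 := hν 1
    have hρ1 := hρ 1
    simp only [pow_one, vectorState_apply] at h1 hμ1 hν1 hρ1
    rw [transformF_zero, transformF_zero, transformF_zero, ← hμ1, ← hν1, ← hρ1,
      mul_apply_eq_comp]
    have h2 := congrArg (inner ℂ Ω) h1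
    simp only [sub_apply, one_apply_eq_self, inner_sub_right,
      inner_smul_right, inner_self_of_norm_one hΩ] at h2
    linear_combination h2
  · have hW := mul_mem hU hV
    have gμ := one_add_psi_ne_zero μ hz
    have gν := one_add_psi_ne_zero ν hz
    have fμ := transformF_of_ne_zero μ hz h0
    have fν := transformF_of_ne_zero ν hz h0
    have fρ := transformF_of_ne_zero ρ hz h0
    set u := (∑' n : ℕ, (z • U) ^ n) Ω with hu
    set v := (∑' n : ℕ, (z • V) ^ n) Ω with hv
    have iu : inner ℂ Ω u = 1 + psi μ z := hμ.inner_resolvent hU hz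
    have iv : inner ℂ Ω v = 1 + psi ν z := hν.inner_resolvent hV hz
    have eu : z • U u = u - Ω := smul_apply_resolvent hU hz Ω
    have ev : z • V v = v - Ω := smul_apply_resolvent hV hz Ω
    have du : V u = u + (1 + psi μ z) • (V Ω - Ω) := by
      have := hUV.resolvent hU hμ hz
      simp only [sub_apply, one_apply_eq_self] at this
      rw [← this, hu]; abel
    have dv : U v = v + (1 + psi ν z) • (U Ω - Ω) := by
      have := hVU.resolvent hV hν hz
      simp only [sub_apply, one_apply_eq_self] at this
      rw [← this, hv]; abel
    have iΩ := inner_self_of_norm_one hΩ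
    set F := transformF μ z
    set E := transformF ν z
    set g := 1 + psi μ z
    set h := 1 + psi ν z
    -- Normalized by `g`, the resolvent vector is `Ω` plus a vector orthogonal to `Ω`. Decoupling
    -- says that `V` fixes this orthogonal part.
    have hVa : V (g⁻¹ • u - Ω) = g⁻¹ • u - Ω := by
      rw [map_sub, map_smul, du, smul_add, inv_smul_smul₀ gμ]
      abel
    have hUb : U (h⁻¹ • v - Ω) = h⁻¹ • v - Ω := by
      rw [map_sub, map_smul, dv, smul_add, inv_smul_smul₀ gν]
      abel
    have hUa : z • U (g⁻¹ • u) = (g⁻¹ • u - Ω) + (z * F) • Ω := by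
      rw [map_smul, smul_comm, eu, fμ]
      module
    have hVb : z • V (h⁻¹ • v) = (h⁻¹ • v - Ω) + (z * E) • Ω := by
      rw [map_smul, smul_comm, ev, fν]
      module
    have hf : ∃ f : H, inner ℂ Ω f = 1 ∧ f - z • (U * V) f = (1 - z * (F * E)) • Ω := by
      -- With `a = g⁻¹u - Ω` and `b = h⁻¹v - Ω` the witness is `Ω + b + E a`. Then `zV` sends it to
      -- `b + zE (Ω + a)`, and `U` sends that to `b + E (a + zF Ω)`.
      refine ⟨E • (g⁻¹ • u - Ω) + h⁻¹ • v, ?_, ?_⟩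
      · simp only [inner_add_right, inner_sub_right, inner_smul_right, iu, iv, iΩ,
          inv_mul_cancel₀ gμ, inv_mul_cancel₀ gν]
        ring
      · have h1 : z • V (E • (g⁻¹ • u - Ω) + h⁻¹ • v) =
            (h⁻¹ • v - Ω) + (z * E) • (g⁻¹ • u) := by
          rw [map_add, map_smul, hVa, smul_add, hVb]
          module
        have h2 : z • U (z • V (E • (g⁻¹ • u - Ω) + h⁻¹ • v)) =
            z • ((h⁻¹ • v - Ω) + E • ((g⁻¹ • u - Ω) + (z * F) • Ω)) := by
          rw [h1, map_add, hUb, map_smul, smul_add, smul_comm z (z * E), hUa]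
          module
        have h3 : z • U (V (E • (g⁻¹ • u - Ω) + h⁻¹ • v)) =
            (h⁻¹ • v - Ω) + E • ((g⁻¹ • u - Ω) + (z * F) • Ω) := by
          rw [← map_smul U]
          refine smul_right_injective H h0 ?_
          simp only [← h2, map_smul]
        rw [mul_apply_eq_comp, h3]
        module
    obtain ⟨f, hf1, hf2⟩ := hf
    have hf3 := resolvent_apply_sub hW hz f
    rw [hf2, map_smul] at hf3
    have hf4 := congrArg (inner ℂ Ω) hf3
    rw [inner_smul_right, hρ.inner_resolvent hW hz, hf1] at hf4
    have hk : (1 + psi ρ z)⁻¹ = 1 - z * (F * E) := (eq_inv_of_mul_eq_one_left hf4).symm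
    apply mul_left_cancel₀ h0
    rw [fρ, hk]
    ring

end

/-! ### Construction of a decoupled realization. -/

open scoped ComplexOrder in
/-- Integration against a probability measure as a positive functional on `C(S¹)`. -/
def integralFunctional (μ : ProbabilityMeasure Circle) : C(Circle, ℂ) →ₚ[ℂ] ℂ :=
  PositiveLinearMap.mk₀
    { toFun := fun f => ∫ x, f x ∂(μ : Measure Circle)
      map_add' := fun f g => integral_add
        (f.continuous.integrable_of_hasCompactSupport (HasCompactSupport.of_compactSpace _))
        (g.continuous.integrable_of_hasCompactSupport (HasCompactSupport.of_compactSpace _))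
      map_smul' := fun c _ => integral_smul c _ }
    fun _ hf => integral_nonneg hf

open scoped ComplexOrder in
/-- Every probability measure on the circle is the distribution of a unitary in a vector state. -/
theorem exists_unitary_hasLaw (μ : ProbabilityMeasure Circle) :
    ∃ (K : Type) (_ : NormedAddCommGroup K) (_ : InnerProductSpace ℂ K) (_ : CompleteSpace K)
      (U : K →L[ℂ] K) (e : K), U ∈ unitary (K →L[ℂ] K) ∧ ‖e‖ = 1 ∧
        HasLaw (vectorState e) U μ := by
  let f := integralFunctional μ
  let χ : C(Circle, ℂ) := ⟨fun x => (x : ℂ), by fun_prop⟩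
  have hχ : χ ∈ unitary C(Circle, ℂ) := by
    rw [Unitary.mem_iff_star_mul_self]
    ext x
    change (starRingEnd ℂ) (x : ℂ) * (x : ℂ) = 1
    rw [← Circle.coe_inv_eq_conj, ← Circle.coe_mul, inv_mul_cancel, Circle.coe_one]
  -- The cyclic vector is the class of the constant function `1`; the unitary is multiplication by
  -- the coordinate.
  let e : f.GNS := ((f.toPreGNS 1 : f.PreGNS) : UniformSpace.Completion f.PreGNS)
  have he : ∀ a : C(Circle, ℂ), vectorState e (f.gnsStarAlgHom a) = f a := fun a => by
    change inner ℂ e (f.gnsNonUnitalStarAlgHom a e) = f a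
    rw [PositiveLinearMap.gnsNonUnitalStarAlgHom_apply_coe, UniformSpace.Completion.inner_coe,
      PositiveLinearMap.preGNS_inner_def]
    simp
  refine ⟨f.GNS, inferInstance, inferInstance, inferInstance, f.gnsStarAlgHom χ, e,
    Unitary.map_mem _ hχ, ?_, fun k => ?_⟩
  · have h1 : inner ℂ e e = (1 : ℂ) := by
      have := he 1
      rw [map_one, vectorState_apply, one_apply_eq_self] at this
      rw [this]
      change ∫ x : Circle, (1 : ℂ) ∂(μ : Measure Circle) = 1
      simp
    rw [norm_eq_sqrt_re_inner (𝕜 := ℂ), h1]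
    simp
  · rw [← map_pow, he]
    rfl

/-- A linear isometric equivalence as a bounded operator. -/
abbrev toOperator {K : Type*} [NormedAddCommGroup K] [InnerProductSpace ℂ K] (U : K ≃ₗᵢ[ℂ] K) :
    K →L[ℂ] K := U.toContinuousLinearEquiv

section
variable {K L : Type*} [NormedAddCommGroup K] [InnerProductSpace ℂ K]
  [NormedAddCommGroup L] [InnerProductSpace ℂ L]

/-- The unitary of `K ⊕ L` which exchanges the unit vectors `(e, 0)` and `(0, f)`. -/
def exchange (e : K) (f : L) : WithLp 2 (K × L) ≃ₗᵢ[ℂ] WithLp 2 (K × L) :=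
  (ℂ ∙ (WithLp.toLp 2 (e, -f)))ᗮ.reflection

theorem exchange_exchange (e : K) (f : L) (x : WithLp 2 (K × L)) :
    exchange e f (exchange e f x) = x :=
  Submodule.reflection_reflection _ x

theorem exchange_apply {e : K} {f : L} (he : ‖e‖ = 1) (hf : ‖f‖ = 1) (x : K) (y : L) :
    exchange e f (WithLp.toLp 2 (x, y)) =
      WithLp.toLp 2
        (x - (inner ℂ e x - inner ℂ f y) • e, y + (inner ℂ e x - inner ℂ f y) • f) := by
  have hn : ‖(WithLp.toLp 2 (e, -f) : WithLp 2 (K × L))‖ ^ 2 = 2 := by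
    rw [WithLp.prod_norm_sq_eq_of_L2]
    simp [he, hf]
    norm_num
  have hi : inner ℂ (WithLp.toLp 2 (e, -f) : WithLp 2 (K × L)) (WithLp.toLp 2 (x, y)) =
      inner ℂ e x - inner ℂ f y := by
    rw [WithLp.prod_inner_apply]
    simp [sub_eq_add_neg]
  rw [exchange, Submodule.reflection_orthogonal_apply, Submodule.reflection_singleton_apply, hi,
    ← RCLike.ofReal_pow, hn]
  simp only [← WithLp.toLp_smul, ← WithLp.toLp_sub, ← WithLp.toLp_neg]
  congr 1
  ext
  · simp
    module
  · simp
    module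

/-- The operator `U ⊕ 1`. -/
def extendLeft (L : Type*) [NormedAddCommGroup L] [InnerProductSpace ℂ L] (U : K ≃ₗᵢ[ℂ] K) :
    WithLp 2 (K × L) ≃ₗᵢ[ℂ] WithLp 2 (K × L) :=
  LinearIsometryEquiv.withLpProdCongr 2 U (LinearIsometryEquiv.refl ℂ L)

/-- The operator `1 ⊕ V`, conjugated by the exchange of `(e, 0)` and `(0, f)`. -/
def extendRight (e : K) (f : L) (V : L ≃ₗᵢ[ℂ] L) : WithLp 2 (K × L) ≃ₗᵢ[ℂ] WithLp 2 (K × L) :=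
  (exchange e f).trans ((LinearIsometryEquiv.withLpProdCongr 2
    (LinearIsometryEquiv.refl ℂ K) V).trans (exchange e f))

theorem extendLeft_apply (U : K ≃ₗᵢ[ℂ] K) (x : K) (y : L) :
    extendLeft L U (WithLp.toLp 2 (x, y)) = WithLp.toLp 2 (U x, y) := rfl

theorem extendRight_exchange (e : K) (f : L) (V : L ≃ₗᵢ[ℂ] L) (x : K) (y : L) :
    extendRight e f V (exchange e f (WithLp.toLp 2 (x, y))) =
      exchange e f (WithLp.toLp 2 (x, V y)) := by
  simp only [extendRight, LinearIsometryEquiv.trans_apply, exchange_exchange]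
  rfl

theorem toLp_eq_exchange {e : K} {f : L} (he : ‖e‖ = 1) (hf : ‖f‖ = 1) :
    WithLp.toLp 2 (e, 0) = exchange e f (WithLp.toLp 2 (0, f)) := by
  rw [exchange_apply he hf]
  simp [hf]

theorem extendLeft_pow_apply (U : K ≃ₗᵢ[ℂ] K) (n : ℕ) (x : K) (y : L) :
    (toOperator (extendLeft L U) ^ n)
      (WithLp.toLp 2 (x, y)) =
      WithLp.toLp 2 ((toOperator U ^ n) x, y) := by
  induction n with
  | zero => rfl
  | succ n ih =>
    rw [pow_succ', pow_succ', mul_apply_eq_comp, ih]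
    rfl

theorem extendRight_pow_exchange (e : K) (f : L) (V : L ≃ₗᵢ[ℂ] L) (n : ℕ) (x : K) (y : L) :
    (toOperator (extendRight e f V) ^ n)
      (exchange e f (WithLp.toLp 2 (x, y))) =
      exchange e f (WithLp.toLp 2 (x, (toOperator V ^ n) y)) := by
  induction n with
  | zero => rfl
  | succ n ih =>
    rw [pow_succ', pow_succ', mul_apply_eq_comp, ih]
    exact extendRight_exchange e f V x _

theorem vectorState_extendLeft_pow (U : K ≃ₗᵢ[ℂ] K) (e : K) (n : ℕ) :
    vectorState (WithLp.toLp 2 (e, (0 : L)))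
      (toOperator (extendLeft L U) ^ n) =
    vectorState e (toOperator U ^ n) := by
  rw [vectorState_apply, extendLeft_pow_apply, WithLp.prod_inner_apply]
  simp [vectorState_apply]

theorem vectorState_extendRight_pow {e : K} {f : L} (he : ‖e‖ = 1) (hf : ‖f‖ = 1)
    (V : L ≃ₗᵢ[ℂ] L) (n : ℕ) :
    vectorState (WithLp.toLp 2 (e, (0 : L)))
      (toOperator (extendRight e f V) ^ n) =
    vectorState f (toOperator V ^ n) := by
  rw [vectorState_apply, toLp_eq_exchange he hf, extendRight_pow_exchange,
    LinearIsometryEquiv.inner_map_map, WithLp.prod_inner_apply]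
  simp [vectorState_apply]

/-- After the exchange, the orbit of `(e, 0)` has its first coordinate in the line of `e`, and `U ⊕
1` is trivial on the second coordinate. -/
theorem decoupled_extendRight_extendLeft {e : K} {f : L} (he : ‖e‖ = 1) (hf : ‖f‖ = 1)
    (U : K ≃ₗᵢ[ℂ] K) (V : L ≃ₗᵢ[ℂ] L) :
    Decoupled (WithLp.toLp 2 (e, (0 : L)))
      (toOperator (extendRight e f V))
      (toOperator (extendLeft L U)) := by
  intro n
  rw [vectorState_extendRight_pow he hf, vectorState_apply]
  nth_rw 1 [toLp_eq_exchange he hf]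
  rw [extendRight_pow_exchange, exchange_apply he hf]
  generalize ((toOperator V ^ n) f) = y
  rw [sub_apply, sub_apply, one_apply_eq_self, one_apply_eq_self]
  change extendLeft L U _ - _ = _ • (extendLeft L U _ - _)
  rw [extendLeft_apply, extendLeft_apply, ← WithLp.toLp_sub, ← WithLp.toLp_sub,
    ← WithLp.toLp_smul]
  congr 1
  ext <;> simp [smul_sub]

/-- A vector `(x, 0)` with `x ⊥ e` is fixed by the exchange and by `1 ⊕ V`, hence by the conjugated
operator. Only the component along `(e, 0)` contributes. -/
theorem decoupled_extendLeft_extendRight {e : K} {f : L} (he : ‖e‖ = 1) (hf : ‖f‖ = 1)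
    (U : K ≃ₗᵢ[ℂ] K) (V : L ≃ₗᵢ[ℂ] L) :
    Decoupled (WithLp.toLp 2 (e, (0 : L)))
      (toOperator (extendLeft L U))
      (toOperator (extendRight e f V)) := by
  intro n
  rw [vectorState_extendLeft_pow, vectorState_apply, extendLeft_pow_apply]
  generalize ((toOperator U ^ n) e) = x
  have h0 : exchange e f (WithLp.toLp 2 (x - inner ℂ e x • e, 0)) =
      WithLp.toLp 2 (x - inner ℂ e x • e, 0) := by
    rw [exchange_apply he hf]
    simp [he]
  have h1 : extendRight e f V (WithLp.toLp 2 (x - inner ℂ e x • e, 0)) =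
      WithLp.toLp 2 (x - inner ℂ e x • e, 0) := by
    nth_rw 1 [← h0]
    rw [extendRight_exchange, map_zero, h0]
  have h2 : (WithLp.toLp 2 (x, 0) : WithLp 2 (K × L)) =
      WithLp.toLp 2 (x - inner ℂ e x • e, 0) + inner ℂ e x • WithLp.toLp 2 (e, 0) := by
    rw [← WithLp.toLp_smul, ← WithLp.toLp_add]
    simp
  rw [sub_apply, sub_apply, one_apply_eq_self, one_apply_eq_self]
  change extendRight e f V _ - _ = _ • (extendRight e f V _ - _)
  rw [h2, map_add, map_smul, h1, smul_sub]
  abel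

end

/-! ### Assembly. -/

/-- Every pair of probability measures on the circle has a realization by decoupled unitaries in
a vector state. -/
theorem exists_decoupled_realization (μ ν : ProbabilityMeasure Circle) :
    ∃ (H : Type) (_ : NormedAddCommGroup H) (_ : InnerProductSpace ℂ H) (_ : CompleteSpace H)
      (Ω : H) (U V : H →L[ℂ] H), ‖Ω‖ = 1 ∧ Decoupled Ω U V ∧ Decoupled Ω V U ∧
        IsRealization (vectorState Ω) U V μ ν := by
  obtain ⟨K, _, _, _, U, e, hU, he, hμ⟩ := exists_unitary_hasLaw μ
  obtain ⟨L, _, _, _, V, f, hV, hf, hν⟩ := exists_unitary_hasLaw ν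
  let U' : K ≃ₗᵢ[ℂ] K := Unitary.linearIsometryEquiv ⟨U, hU⟩
  let V' : L ≃ₗᵢ[ℂ] L := Unitary.linearIsometryEquiv ⟨V, hV⟩
  have hΩ : ‖(WithLp.toLp 2 (e, 0) : WithLp 2 (K × L))‖ = 1 := by
    simp [he]
  have h1 := decoupled_extendLeft_extendRight he hf U' V'
  have h2 := decoupled_extendRight_extendLeft he hf U' V'
  refine ⟨WithLp 2 (K × L), inferInstance, inferInstance, inferInstance, WithLp.toLp 2 (e, 0),
    _, _, hΩ, h1, h2, ⟨isNormalState_vectorState hΩ,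
      (Unitary.linearIsometryEquiv.symm (extendLeft L U')).2,
      (Unitary.linearIsometryEquiv.symm (extendRight e f V')).2, fun k => ?_, fun k => ?_,
      h1.booleanIndep hΩ h2⟩⟩
  · exact (vectorState_extendLeft_pow U' e k).trans (hμ k)
  · exact (vectorState_extendRight_pow he hf V' k).trans (hν k)

theorem exists_decoupled_isBoolConv (μ ν : ProbabilityMeasure Circle) :
    ∃ (H : Type) (_ : NormedAddCommGroup H) (_ : InnerProductSpace ℂ H) (_ : CompleteSpace H)
      (Ω : H) (U V : H →L[ℂ] H), ‖Ω‖ = 1 ∧ Decoupled Ω U V ∧ Decoupled Ω V U ∧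
        IsRealization (vectorState Ω) U V μ ν ∧
        HasLaw (vectorState Ω) (U * V) (boolConv μ ν) := by
  obtain ⟨H, _, _, _, Ω, U, V, hΩ, hUV, hVU, hr⟩ := exists_decoupled_realization μ ν
  obtain ⟨ρ, hρ⟩ := exists_hasLaw hr.normalState.nonneg hr.normalState.map_one
    (mul_mem hr.unitary_left hr.unitary_right)
  have hex : ∃ ρ, IsBoolConv μ ν ρ := ⟨ρ, H, _, _, _, _, U, V, hr, hρ⟩
  refine ⟨H, _, _, _, Ω, U, V, hΩ, hUV, hVU, hr, fun k => ?_⟩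
  -- The chosen convolution may come from another realization; equality of moments transfers it to
  -- this one.
  obtain ⟨H', _, _, _, φ', U', V', hr', hρ'⟩ := hex.choose_spec
  rw [boolConv, dif_pos hex, ← hρ' k, hr.map_mul_pow hr' k]

end BooleanConvolution

end

theorem proposition3p4 (μ ν : MeasureTheory.ProbabilityMeasure Circle) :
    BooleanConvolution.IsBoolConv μ ν (BooleanConvolution.boolConv μ ν) ∧
    (∀ (H : Type*) [NormedAddCommGroup H] [InnerProductSpace ℂ H] [CompleteSpace H]
      (φ : (H →L[ℂ] H) →ₗ[ℂ] ℂ) (U V : H →L[ℂ] H),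
      BooleanConvolution.IsRealization φ U V μ ν →
      ∀ ρ : MeasureTheory.ProbabilityMeasure Circle,
        BooleanConvolution.HasLaw φ (U * V) ρ ↔ ρ = BooleanConvolution.boolConv μ ν) ∧
    ∀ z : ℂ, ‖z‖ < 1 →
      BooleanConvolution.transformF (BooleanConvolution.boolConv μ ν) z =
        BooleanConvolution.transformF μ z * BooleanConvolution.transformF ν z := by
  obtain ⟨H₀, _, _, _, Ω, U₀, V₀, hΩ, hUV, hVU, hr₀, hρ₀⟩ :=
    BooleanConvolution.exists_decoupled_isBoolConv μ ν
  refine ⟨⟨H₀, _, _, _, _, U₀, V₀, hr₀, hρ₀⟩, ?_, fun z hz => ?_⟩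
  · intro H _ _ _ φ U V hr ρ
    have hm := fun k => (hr.map_mul_pow hr₀ k).trans (hρ₀ k)
    constructor
    · intro hρ
      exact BooleanConvolution.ext_of_moments fun k => (hρ k).symm.trans (hm k)
    · rintro rfl
      exact hm
  · exact hUV.transformF_mul hΩ hVU hr₀.unitary_left hr₀.unitary_right hr₀.law_left
      hr₀.law_right hρ₀ hz
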